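/- Let $r\ge 1$ be an integer and let $H$ be a finite simple graph with chromatic number $\chi(H)=r+1$. For each $n$, let $ex_{c_r}(n,H)$ denote the maximum number of $r$-cliques (sets of $r$ pairwise adjacent vertices) in an $n$-vertex simple graph that is $H$-free, i.e. contains no (not necessarily induced) subgraph isomorphic to $H$. Then $$ex_{c_r}(n,H)=\left(\frac{1}{r^{r}}+o(1)\right)n^{r}\qquad (n\to\infty),$$ where the $o(1)$ term may depend on $H$. -/

import Mathlib

open Filter Topology

open scoped Classical in
/-- The maximum number of `t`-cliques in an `H`-free graph on `n` labelled vertices, where `H`-free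
means that there is no (not necessarily induced) subgraph isomorphic to `H`.
If there is no `H`-free graph on `n` vertices, then this is `0`. -/
noncomputable def exClique {W : Type*} (t n : ℕ) (H : SimpleGraph W) : ℕ :=
  Finset.sup {G : SimpleGraph (Fin n) | H.Free G} fun G => (G.cliqueFinset t).card

open scoped Classical in
/-- `exClique t n H` is an actual maximum as soon as `H` has an edge. -/
theorem isGreatest_exClique {W : Type*} (t n : ℕ) {H : SimpleGraph W} (hH : H ≠ ⊥) :
    IsGreatest {c : ℕ | ∃ G : SimpleGraph (Fin n), H.Free G ∧ (G.cliqueFinset t).card = c}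
      (exClique t n H) := by
  have hne : (Finset.univ.filter fun G : SimpleGraph (Fin n) => H.Free G).Nonempty := by
    refine ⟨⊥, ?_⟩
    simp only [Finset.mem_filter, Finset.mem_univ, true_and]
    exact SimpleGraph.free_bot hH
  constructor
  · obtain ⟨G, hG, h⟩ := Finset.exists_mem_eq_sup _ hne
      (fun G : SimpleGraph (Fin n) => (G.cliqueFinset t).card)
    exact ⟨G, (Finset.mem_filter.1 hG).2, h.symm⟩
  · rintro c ⟨G, hG, rfl⟩
    exact Finset.le_sup (f := fun G : SimpleGraph (Fin n) => (G.cliqueFinset t).card)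
      (Finset.mem_filter.2 ⟨Finset.mem_univ _, hG⟩)

/-! Lower bound: the Turán graph with `r` parts is `r`-colorable, so it contains no copy of `H`, and
it has at least `(n / r) ^ r` cliques of size `r`. Upper bound: as `H` is `(r + 1)`-colorable,
Erdős's box argument shows that an `H`-free graph has only `o(n ^ (r + 1))` cliques of size `r + 1`
(`Colorable.eventually_card_cliqueFinset_le`). If there are at least `n ^ r / r ^ r` cliques of size
`r`, this is at most `η * n` times their number. The Moon–Moser inequality carries this ratio bound
down to all smaller sizes (`card_cliqueFinset_succ_le`), and multiplying the ratios gives a constant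
that tends to `1 / r ^ r` as `η → 0`. -/

/-! ### Counting boxes: few large cliques in an `H`-free graph -/

theorem pow_mul_card_le_sum_pow {ι : Type*} (s : Finset ι) (f : ι → ℝ) (hf : ∀ i ∈ s, 0 ≤ f i)
    {c : ℝ} (hc : 0 ≤ c) (h : c * s.card ≤ ∑ i ∈ s, f i) (m : ℕ) :
    c ^ m * s.card ≤ ∑ i ∈ s, f i ^ m := by
  rcases m with _ | m
  · simp
  rcases s.eq_empty_or_nonempty with rfl | hs
  · simp
  have hpos : (0 : ℝ) < s.card := by exact_mod_cast hs.card_pos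
  refine le_trans ?_ (pow_sum_div_card_le_sum_pow hf m)
  rw [le_div_iff₀ (by positivity)]
  calc c ^ (m + 1) * s.card * (s.card : ℝ) ^ m = (c * s.card) ^ (m + 1) := by ring
    _ ≤ _ := by gcongr

open scoped Classical in
/-- A set of `k`-tuples of density `c` contains at least a `c ^ (w ^ k)` proportion of all
boxes with sides of size `w`. -/
theorem pow_mul_card_pow_le_card_boxes {V W : Type*} [Fintype V] [Nonempty V] [Fintype W] (k : ℕ) :
    ∀ (S : Finset (Fin k → V)) (c : ℝ), 0 ≤ c → c * (Fintype.card V : ℝ) ^ k ≤ S.card →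
    c ^ (Fintype.card W ^ k) * (Fintype.card V : ℝ) ^ (k * Fintype.card W) ≤
      (Finset.univ.filter fun φ : Fin k → W → V =>
        ∀ w : Fin k → W, (fun i => φ i (w i)) ∈ S).card := by
  have hV : (0 : ℝ) < Fintype.card V := by exact_mod_cast Fintype.card_pos
  induction k with
  | zero =>
    intro S c hc hS
    simp only [pow_zero, mul_one, pow_one, zero_mul] at hS ⊢
    refine hS.trans ?_
    rcases S.eq_empty_or_nonempty with rfl | ⟨x, hx⟩
    · simp
    · have h1 : S.card ≤ 1 := (Finset.card_le_univ S).trans (by simp)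
      have h2 : (Finset.univ.filter fun φ : Fin 0 → W → V =>
        ∀ w : Fin 0 → W, (fun i => φ i (w i)) ∈ S).Nonempty := by
        refine ⟨Fin.elim0, ?_⟩
        simp only [Finset.mem_filter, Finset.mem_univ, true_and]
        intro w
        rwa [Subsingleton.elim (fun i => _) x]
      exact_mod_cast h1.trans h2.card_pos
  | succ k ih =>
    intro S c hc hS
    set n := Fintype.card V with hn
    -- Fix the first side `u` of the box: the other sides must then form a box inside the common
    -- link `T u`. Counting pairs `(u, y)` with `y ∈ T u` by `y` gives powers of the degrees `d y`.
    let T : (W → V) → Finset (Fin k → V) := fun u =>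
      Finset.univ.filter fun y => ∀ a, Fin.cons (u a) y ∈ S
    let d : (Fin k → V) → ℕ := fun y => (Finset.univ.filter fun x => Fin.cons x y ∈ S).card
    have hsum : ∑ y, d y = S.card := by
      simp only [d, Finset.card_filter]
      rw [Finset.sum_comm, ← Fintype.sum_prod_type']
      refine ((Fin.consEquiv fun _ : Fin (k + 1) => V).sum_comp
        (fun z => if z ∈ S then 1 else 0)).trans ?_
      simp
    have hTsum : ∑ u, (T u).card = ∑ y, d y ^ Fintype.card W := by
      simp only [T, Finset.card_filter]
      rw [Finset.sum_comm]
      refine Finset.sum_congr rfl fun y _ => ?_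
      have hfun : d y ^ Fintype.card W =
          Fintype.card (W → {x // (Fin.cons x y : Fin (k + 1) → V) ∈ S}) := by
        rw [Fintype.card_fun, Fintype.card_subtype]
      rw [← Finset.card_filter, hfun, ← Fintype.card_subtype]
      exact Fintype.card_congr
        { toFun := fun u a => ⟨u.1 a, u.2 a⟩
          invFun := fun g => ⟨fun a => (g a).1, fun a => (g a).2⟩
          left_inv := fun _ => rfl
          right_inv := fun _ => rfl }
    have h1 : c ^ Fintype.card W * (n : ℝ) ^ Fintype.card W * (n : ℝ) ^ k ≤
        ∑ u, ((T u).card : ℝ) := by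
      have := pow_mul_card_le_sum_pow (Finset.univ : Finset (Fin k → V)) (fun y => (d y : ℝ))
        (fun _ _ => Nat.cast_nonneg _) (c := c * n) (by positivity) (by
          rw [← Nat.cast_sum, hsum]
          refine le_trans (le_of_eq ?_) hS
          rw [Finset.card_univ, Fintype.card_fun, Fintype.card_fin, ← hn, Nat.cast_pow]
          ring) (Fintype.card W)
      rw [← Nat.cast_sum, hTsum]
      push_cast
      refine le_trans (le_of_eq ?_) this
      rw [mul_pow, Finset.card_univ, Fintype.card_fun, Fintype.card_fin, ← hn, Nat.cast_pow]
    -- Second use of convexity: the average density of `T u` is at least `c ^ |W|`, and induction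
    -- raises each density to the power `|W| ^ k`.
    have h2 := pow_mul_card_le_sum_pow (Finset.univ : Finset (W → V))
      (fun u => ((T u).card : ℝ) / (n : ℝ) ^ k) (fun _ _ => by positivity)
      (c := c ^ Fintype.card W) (by positivity) (by
        rw [← Finset.sum_div, le_div_iff₀ (by positivity)]
        simpa [← hn] using h1) (Fintype.card W ^ k)
    have h3 : (Finset.univ.filter fun φ : Fin (k + 1) → W → V =>
          ∀ w : Fin (k + 1) → W, (fun i => φ i (w i)) ∈ S).card =
        ∑ u : W → V, (Finset.univ.filter fun φ : Fin k → W → V =>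
          ∀ w : Fin k → W, (fun i => φ i (w i)) ∈ T u).card := by
      simp only [Finset.card_filter]
      rw [← (Fin.consEquiv fun _ : Fin (k + 1) => W → V).sum_comp, Fintype.sum_prod_type]
      refine Finset.sum_congr rfl fun u _ => Finset.sum_congr rfl fun φ _ => ?_
      refine if_congr ?_ rfl rfl
      have key : ∀ (a : W) (w : Fin k → W),
          (fun i => (Fin.cons u φ : Fin (k + 1) → W → V) i ((Fin.cons a w : Fin (k + 1) → W) i)) =
            (Fin.cons (u a) (fun i => φ i (w i)) : Fin (k + 1) → V) := by
        intro a w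
        ext i
        refine Fin.cases ?_ (fun i => ?_) i <;> simp
      constructor
      · intro h w
        simp only [T, Finset.mem_filter, Finset.mem_univ, true_and]
        intro a
        rw [← key]
        exact h _
      · intro h w
        have := h (Fin.tail w)
        simp only [T, Finset.mem_filter, Finset.mem_univ, true_and] at this
        have := this (w 0)
        rw [← key, Fin.cons_self_tail] at this
        exact this
    rw [h3]
    push_cast
    calc c ^ (Fintype.card W ^ (k + 1)) * (n : ℝ) ^ ((k + 1) * Fintype.card W)
        = (c ^ Fintype.card W) ^ (Fintype.card W ^ k) *
            ((Finset.univ : Finset (W → V)).card : ℝ) * (n : ℝ) ^ (k * Fintype.card W) := by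
          rw [Finset.card_univ, Fintype.card_fun, ← hn, Nat.cast_pow]
          ring
      _ ≤ (∑ u : W → V, (((T u).card : ℝ) / (n : ℝ) ^ k) ^ (Fintype.card W ^ k)) *
            (n : ℝ) ^ (k * Fintype.card W) := by gcongr
      _ ≤ _ := by
          rw [Finset.sum_mul]
          refine Finset.sum_le_sum fun u _ => ih (T u) _ (by positivity) ?_
          rw [div_mul_cancel₀ _ (by positivity)]

theorem eventually_pow_lt_descFactorial_add (m : ℕ) {c : ℝ} (hc : 0 < c) :
    ∀ᶠ n : ℕ in atTop, (n : ℝ) ^ m < n.descFactorial m + c * (n : ℝ) ^ m := by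
  have hlim : Tendsto (fun n : ℕ => (1 - (m : ℝ) / n) ^ m) atTop (𝓝 1) := by
    have := ((tendsto_const_div_atTop_nhds_zero_nat (m : ℝ)).const_sub 1).pow m
    simpa using this
  filter_upwards [hlim.eventually (lt_mem_nhds (show (1 : ℝ) - c < 1 by linarith)),
    eventually_ge_atTop (m + 1)] with n hn hmn
  have hn0 : (0 : ℝ) < n := by exact_mod_cast (by omega : 0 < n)
  have hcast : (m : ℝ) ≤ n := by exact_mod_cast (by omega : m ≤ n)
  have h1 : ((n : ℝ) - m) ^ m ≤ n.descFactorial m := by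
    have := Nat.pow_sub_le_descFactorial n m
    have h2 : (n - m) ^ m ≤ n.descFactorial m :=
      (Nat.pow_le_pow_left (by omega) m).trans this
    have h3 : (((n - m) ^ m : ℕ) : ℝ) ≤ n.descFactorial m := by exact_mod_cast h2
    rwa [Nat.cast_pow, Nat.cast_sub (by omega)] at h3
  have h2 : (1 - (m : ℝ) / n) ^ m * (n : ℝ) ^ m = ((n : ℝ) - m) ^ m := by
    rw [← mul_pow, sub_mul, div_mul_cancel₀ _ hn0.ne', one_mul]
  have h3 : (1 - c) * (n : ℝ) ^ m < (1 - (m : ℝ) / n) ^ m * (n : ℝ) ^ m := by gcongr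
  linarith

theorem SimpleGraph.card_cliqueFinset_le_card_tuples {V : Type*} [Fintype V] [DecidableEq V]
    (G : SimpleGraph V) [DecidableRel G.Adj] (k : ℕ) :
    (G.cliqueFinset k).card ≤
      (Finset.univ.filter fun f : Fin k → V => ∀ i j, i ≠ j → G.Adj (f i) (f j)).card := by
  refine (Finset.card_le_card ?_).trans
    (Finset.card_image_le (f := fun f : Fin k → V => Finset.univ.image f))
  intro T hT
  rw [SimpleGraph.mem_cliqueFinset_iff] at hT
  let e := T.equivFinOfCardEq hT.card_eq
  refine Finset.mem_image.2 ⟨fun i => (e.symm i).1, ?_, ?_⟩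
  · simp only [Finset.mem_filter, Finset.mem_univ, true_and]
    intro i j hij
    refine hT.isClique (e.symm i).2 (e.symm j).2 fun h => hij ?_
    exact e.symm.injective (Subtype.ext h)
  · ext x
    simp only [Finset.mem_image, Finset.mem_univ, true_and]
    constructor
    · rintro ⟨i, rfl⟩
      exact (e.symm i).2
    · intro hx
      exact ⟨e ⟨x, hx⟩, by simp⟩

open scoped Classical in
/-- An `H`-free graph, where `H` is `k`-colorable, has only `o(n ^ k)` cliques of size `k`. -/
theorem SimpleGraph.Colorable.eventually_card_cliqueFinset_le {W : Type*} [Finite W]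
    {H : SimpleGraph W} {k : ℕ} (hH : H.Colorable k) {c : ℝ} (hc : 0 < c) :
    ∀ᶠ n : ℕ in atTop, ∀ G : SimpleGraph (Fin n), H.Free G →
      ((G.cliqueFinset k).card : ℝ) ≤ c * (n : ℝ) ^ k := by
  have := Fintype.ofFinite W
  obtain ⟨C⟩ := hH
  filter_upwards [eventually_pow_lt_descFactorial_add (k * Fintype.card W)
    (pow_pos hc (Fintype.card W ^ k)), eventually_ge_atTop 1] with n hn hn1 G hG
  by_contra! hlt
  have : Nonempty (Fin n) := ⟨⟨0, hn1⟩⟩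
  let S := Finset.univ.filter fun f : Fin k → Fin n => ∀ i j, i ≠ j → G.Adj (f i) (f j)
  have hS := pow_mul_card_pow_le_card_boxes (W := W) k S c hc.le (by
    rw [Fintype.card_fin]
    exact hlt.le.trans (by exact_mod_cast G.card_cliqueFinset_le_card_tuples k))
  rw [Fintype.card_fin] at hS
  set B := Finset.univ.filter fun φ : Fin k → W → Fin n =>
    ∀ w : Fin k → W, (fun i => φ i (w i)) ∈ S with hB
  let I := Finset.univ.filter fun φ : Fin k → W → Fin n => (Function.uncurry φ).Injective
  have hI : I.card = n.descFactorial (k * Fintype.card W) := by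
    have h := Fintype.card_embedding_eq (α := Fin k × W) (β := Fin n)
    rw [Fintype.card_prod, Fintype.card_fin, Fintype.card_fin] at h
    rw [← h, ← Fintype.card_subtype]
    exact Fintype.card_congr
      { toFun := fun φ => ⟨Function.uncurry φ.1, φ.2⟩
        invFun := fun e => ⟨Function.curry e, by simpa using e.injective⟩
        left_inv := fun _ => rfl
        right_inv := fun _ => rfl }
  -- Almost all `φ` are injective, while boxes have positive density, so some box has distinct
  -- vertices.
  have hne : ¬ Disjoint B I := by
    intro hd
    have h1 : B.card + I.card ≤ n ^ (k * Fintype.card W) := by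
      rw [← Finset.card_union_of_disjoint hd]
      refine (Finset.card_le_univ _).trans (le_of_eq ?_)
      simp [← pow_mul, mul_comm]
    have h2 : (B.card : ℝ) + I.card ≤ (n : ℝ) ^ (k * Fintype.card W) := by exact_mod_cast h1
    rw [hI] at h2
    have h3 : c ^ (Fintype.card W ^ k) * (n : ℝ) ^ (k * Fintype.card W) ≤ B.card := by
      convert hS
    linarith
  obtain ⟨φ, hφB, hφI⟩ := Finset.not_disjoint_iff.1 hne
  simp only [hB, S, I, Finset.mem_filter, Finset.mem_univ, true_and] at hφB hφI
  -- Each color class is placed on its own side of the box; an edge `ab` is seen in any tuple using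
  -- `a` at `C a` and `b` at `C b`.
  refine hG ⟨⟨⟨fun v => φ (C v) v, ?_⟩, ?_⟩⟩
  · intro a b hab
    have hne : C a ≠ C b := C.valid hab
    have := hφB (fun i => if i = C a then a else b) (C a) (C b) hne
    simpa [hne.symm] using this
  · intro a b hab
    exact congrArg Prod.snd (hφI (a₁ := (C a, a)) (a₂ := (C b, b)) hab)

/-! ### Moon–Moser and ratios of clique numbers -/

namespace SimpleGraph

variable {V : Type*} [Fintype V] [DecidableEq V] (G : SimpleGraph V) [DecidableRel G.Adj]

/-- The vertices adjacent to all vertices of `Q`. -/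
def commonNbrs (Q : Finset V) : Finset V := Finset.univ.filter fun v => ∀ u ∈ Q, G.Adj u v

theorem mem_commonNbrs {Q : Finset V} {v : V} : v ∈ G.commonNbrs Q ↔ ∀ u ∈ Q, G.Adj u v := by
  simp [commonNbrs]

/-- Double counting through the bijection `(T, x) ↔ (T.erase x, x)`. -/
theorem sum_cliqueFinset_succ_sum_erase (s : ℕ) (F : Finset V → ℕ) :
    ∑ T ∈ G.cliqueFinset (s + 1), ∑ x ∈ T, F (T.erase x) =
      ∑ Q ∈ G.cliqueFinset s, (G.commonNbrs Q).card * F Q := by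
  simp_rw [← smul_eq_mul, ← Finset.sum_const]
  rw [Finset.sum_sigma', Finset.sum_sigma']
  refine Finset.sum_bij' (fun p _ => ⟨p.1.erase p.2, p.2⟩) (fun p _ => ⟨insert p.2 p.1, p.2⟩)
    ?_ ?_ ?_ ?_ ?_
  · rintro ⟨T, x⟩ h
    simp only [Finset.mem_sigma, mem_cliqueFinset_iff, mem_commonNbrs] at h ⊢
    obtain ⟨hT, hx⟩ := h
    refine ⟨⟨hT.isClique.subset (by simp), by simp [Finset.card_erase_of_mem hx, hT.card_eq]⟩, ?_⟩
    intro u hu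
    rw [Finset.mem_erase] at hu
    exact hT.isClique hu.2 hx hu.1
  · rintro ⟨Q, x⟩ h
    simp only [Finset.mem_sigma, mem_cliqueFinset_iff, mem_commonNbrs] at h ⊢
    exact ⟨h.1.insert fun u hu => (h.2 u hu).symm, Finset.mem_insert_self _ _⟩
  · rintro ⟨T, x⟩ h
    simp only [Finset.mem_sigma] at h
    simp [Finset.insert_erase h.2]
  · rintro ⟨Q, x⟩ h
    simp only [Finset.mem_sigma, mem_cliqueFinset_iff, mem_commonNbrs] at h
    have : x ∉ Q := fun hx => G.irrefl (h.2 x hx)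
    simp [Finset.erase_insert this]
  · rintro ⟨T, x⟩ h
    rfl

theorem sum_cliqueFinset_card_commonNbrs (s : ℕ) :
    ∑ Q ∈ G.cliqueFinset s, (G.commonNbrs Q).card = (s + 1) * (G.cliqueFinset (s + 1)).card := by
  have h := G.sum_cliqueFinset_succ_sum_erase s (fun _ => 1)
  simp only [Finset.sum_const, smul_eq_mul, mul_one] at h
  rw [← h, Finset.sum_congr rfl fun T hT => ((G.mem_cliqueFinset_iff).1 hT).card_eq]
  simp [mul_comm]

/-- A vertex outside `G.commonNbrs T` is counted at most once, because two distinct erasures of `T`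
together cover `T`. -/
theorem sum_card_commonNbrs_erase_le {s : ℕ} {T : Finset V} (hT : T.card = s + 1) :
    ∑ x ∈ T, (G.commonNbrs (T.erase x)).card ≤ Fintype.card V + s * (G.commonNbrs T).card := by
  have hpt : ∀ v, (∑ x ∈ T, if v ∈ G.commonNbrs (T.erase x) then 1 else 0) ≤
      1 + s * (if v ∈ G.commonNbrs T then 1 else 0) := by
    intro v
    rw [← Finset.card_filter]
    split_ifs with hv
    · have := Finset.card_filter_le T fun x => v ∈ G.commonNbrs (T.erase x)
      omega
    · rw [mul_zero, add_zero, Finset.card_le_one]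
      intro x hx y hy
      by_contra hxy
      simp only [Finset.mem_filter, mem_commonNbrs, Finset.mem_erase] at hx hy
      refine hv (G.mem_commonNbrs.2 fun u hu => ?_)
      by_cases hux : u = x
      · exact hy.2 u ⟨fun h => hxy (hux.symm.trans h), hu⟩
      · exact hx.2 u ⟨hux, hu⟩
  have hcard : ∀ Q, (G.commonNbrs Q).card = ∑ v, if v ∈ G.commonNbrs Q then 1 else 0 := by
    intro Q
    simp
  simp_rw [hcard]
  rw [Finset.sum_comm]
  refine (Finset.sum_le_sum fun v _ => hpt v).trans (le_of_eq ?_)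
  rw [Finset.sum_add_distrib, Finset.mul_sum]
  simp

/-- The **Moon–Moser inequality** between the numbers of cliques of consecutive sizes. -/
theorem moon_moser (s : ℕ) :
    ((s + 1) * (G.cliqueFinset (s + 1)).card) ^ 2 ≤ (G.cliqueFinset s).card *
      (Fintype.card V * (G.cliqueFinset (s + 1)).card +
        s * ((s + 2) * (G.cliqueFinset (s + 2)).card)) := by
  rw [← G.sum_cliqueFinset_card_commonNbrs s]
  refine sq_sum_le_card_mul_sum_sq.trans (Nat.mul_le_mul_left _ ?_)
  simp_rw [sq]
  rw [← G.sum_cliqueFinset_succ_sum_erase s fun Q => (G.commonNbrs Q).card]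
  refine (Finset.sum_le_sum fun T hT =>
    G.sum_card_commonNbrs_erase_le ((G.mem_cliqueFinset_iff).1 hT).card_eq).trans (le_of_eq ?_)
  rw [Finset.sum_add_distrib, ← Finset.mul_sum, G.sum_cliqueFinset_card_commonNbrs (s + 1)]
  simp [mul_comm]

/-- Downward induction from `s = r`, where the main term vanishes. With `η = 0` the ratios are those
of the balanced complete `r`-partite graph. -/
theorem card_cliqueFinset_succ_le {r : ℕ} (hr : 1 ≤ r) {η : ℝ} (hη : 0 ≤ η)
    (h : ((G.cliqueFinset (r + 1)).card : ℝ) ≤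
      η * Fintype.card V * (G.cliqueFinset r).card) {s : ℕ} (hs : s ≤ r) :
    ((G.cliqueFinset (s + 1)).card : ℝ) ≤
      (((r : ℝ) - s) / (r * (s + 1)) + η) * Fintype.card V * (G.cliqueFinset s).card := by
  have hr0 : (0 : ℝ) < r := by exact_mod_cast hr
  induction hs using Nat.decreasingInduction with
  | self => simpa using h
  | of_succ s hsr ih =>
    have hsr' : (s : ℝ) + 1 ≤ r := by exact_mod_cast hsr
    have hmm : (((s + 1) * (G.cliqueFinset (s + 1)).card) ^ 2 : ℝ) ≤ (G.cliqueFinset s).card *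
      (Fintype.card V * (G.cliqueFinset (s + 1)).card +
        s * ((s + 2) * (G.cliqueFinset (s + 2)).card)) := by exact_mod_cast G.moon_moser s
    rw [show s + 1 + 1 = s + 2 from rfl] at ih
    push_cast at ih
    generalize ((G.cliqueFinset (s + 2)).card : ℝ) = z at *
    have hx : (0 : ℝ) ≤ (G.cliqueFinset s).card := Nat.cast_nonneg _
    have hy : (0 : ℝ) ≤ (G.cliqueFinset (s + 1)).card := Nat.cast_nonneg _
    have hn : (0 : ℝ) ≤ Fintype.card V := Nat.cast_nonneg _
    generalize ((G.cliqueFinset s).card : ℝ) = x at *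
    generalize ((G.cliqueFinset (s + 1)).card : ℝ) = y at *
    generalize (Fintype.card V : ℝ) = n at *
    have hs0 : (0 : ℝ) ≤ s := Nat.cast_nonneg _
    generalize (s : ℝ) = t at *
    generalize (r : ℝ) = ρ at *
    rcases hy.eq_or_lt with rfl | hy
    · have : 0 ≤ (ρ - t) / (ρ * (t + 1)) := div_nonneg (by linarith) (by positivity)
      positivity
    -- Since `(t + 1) ^ 2 = t * (t + 2) + 1`, the error does not grow: the same `η` serves at every
    -- level.
    have hcoef : 1 + t * (t + 2) * ((ρ - (t + 1)) / (ρ * (t + 1 + 1)) + η) ≤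
        (t + 1) ^ 2 * ((ρ - t) / (ρ * (t + 1)) + η) := by
      have h1 : 1 + t * (t + 2) * ((ρ - (t + 1)) / (ρ * (t + 1 + 1)) + η) + η =
        (t + 1) ^ 2 * ((ρ - t) / (ρ * (t + 1)) + η) := by
        field_simp
        ring
      linarith
    have h1 : (t + 1) ^ 2 * y * y ≤ (t + 1) ^ 2 * ((((ρ - t) / (ρ * (t + 1)) + η)) * n * x) * y :=
      calc (t + 1) ^ 2 * y * y = ((t + 1) * y) ^ 2 := by ring
        _ ≤ x * (n * y + t * ((t + 2) * z)) := hmm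
        _ ≤ x * (n * y + t * ((t + 2) * (((ρ - (t + 1)) / (ρ * (t + 1 + 1)) + η) * n * y))) := by
            gcongr
        _ = (1 + t * (t + 2) * ((ρ - (t + 1)) / (ρ * (t + 1 + 1)) + η)) * (x * n * y) := by ring
        _ ≤ (t + 1) ^ 2 * ((ρ - t) / (ρ * (t + 1)) + η) * (x * n * y) := by gcongr
        _ = _ := by ring
    exact le_of_mul_le_mul_left (le_of_mul_le_mul_right h1 hy) (by positivity)

theorem card_cliqueFinset_le_prod {r : ℕ} (hr : 1 ≤ r) {η : ℝ} (hη : 0 ≤ η)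
    (h : ((G.cliqueFinset (r + 1)).card : ℝ) ≤
      η * Fintype.card V * (G.cliqueFinset r).card) {s : ℕ} (hs : s ≤ r) :
    ((G.cliqueFinset s).card : ℝ) ≤
      (∏ i ∈ Finset.range s, (((r : ℝ) - i) / (r * (i + 1)) + η)) * (Fintype.card V : ℝ) ^ s := by
  induction s with
  | zero =>
    have : (G.cliqueFinset 0).card ≤ 1 := by
      rw [Finset.card_le_one]
      intro a ha b hb
      rw [mem_cliqueFinset_iff] at ha hb
      rw [Finset.card_eq_zero.1 ha.card_eq, Finset.card_eq_zero.1 hb.card_eq]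
    simpa using this
  | succ s ih =>
    have hsr : (s : ℝ) ≤ r := by exact_mod_cast (by omega : s ≤ r)
    have hnn : 0 ≤ ((r : ℝ) - s) / (r * (s + 1)) := div_nonneg (by linarith) (by positivity)
    rw [Finset.prod_range_succ]
    refine (G.card_cliqueFinset_succ_le hr hη h (by omega)).trans ?_
    calc _ ≤ (((r : ℝ) - s) / (r * (s + 1)) + η) * Fintype.card V *
          ((∏ i ∈ Finset.range s, (((r : ℝ) - i) / (r * (i + 1)) + η)) *
            (Fintype.card V : ℝ) ^ s) := by
          gcongr
          exact ih (by omega)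
      _ = _ := by ring

/-! ### Cliques in the Turán graph -/

theorem div_pow_le_card_cliqueFinset_turanGraph {n r : ℕ} :
    (n / r) ^ r ≤ ((turanGraph n r).cliqueFinset r).card := by
  have hlt : ∀ (f : Fin r → Fin (n / r)) i, (f i : ℕ) * r + i < n := fun f i =>
    calc (f i : ℕ) * r + i < (f i : ℕ) * r + r := by have := i.2; omega
      _ = ((f i : ℕ) + 1) * r := by ring
      _ ≤ n / r * r := Nat.mul_le_mul_right _ (f i).2
      _ ≤ n := Nat.div_mul_le_self n r
  have hmod : ∀ (f : Fin r → Fin (n / r)) i, ((f i : ℕ) * r + i) % r = i := fun f i => by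
    rw [Nat.mul_add_mod', Nat.mod_eq_of_lt i.2]
  -- One vertex from each residue class mod `r`; the residue recovers `i`, so the vertex set
  -- determines `f`.
  let c : (Fin r → Fin (n / r)) → Fin r → Fin n := fun f i => ⟨(f i : ℕ) * r + i, hlt f i⟩
  have hc : ∀ f i g j, c f i = c g j → i = j := fun f i g j h => by
    have h1 : (f i : ℕ) * r + i = (g j : ℕ) * r + j := congrArg Fin.val h
    exact Fin.ext (by rw [← hmod f i, h1, hmod g j])
  calc (n / r) ^ r = (Finset.univ : Finset (Fin r → Fin (n / r))).card := by simp
    _ ≤ _ := Finset.card_le_card_of_injOn (fun f => Finset.univ.image (c f)) ?_ ?_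
  · intro f _
    rw [Finset.mem_coe, mem_cliqueFinset_iff, isNClique_iff]
    constructor
    · intro x hx y hy hxy
      simp only [Finset.coe_image, Finset.coe_univ, Set.image_univ, Set.mem_range] at hx hy
      obtain ⟨i, rfl⟩ := hx
      obtain ⟨j, rfl⟩ := hy
      rw [turanGraph_adj]
      simp only [c, hmod]
      intro hij
      exact hxy (congrArg (c f) (Fin.ext hij))
    · rw [Finset.card_image_of_injective _ fun i j => hc f i f j]
      simp
  · intro f _ g _ hfg
    funext i
    have hi : c f i ∈ Finset.univ.image (c g) := by
      rw [← show Finset.univ.image (c f) = Finset.univ.image (c g) from hfg]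
      exact Finset.mem_image_of_mem _ (Finset.mem_univ i)
    obtain ⟨j, -, hj⟩ := Finset.mem_image.1 hi
    obtain rfl := hc g j f i hj
    have h1 : (g j : ℕ) * r + j = (f j : ℕ) * r + j := congrArg Fin.val hj
    exact Fin.ext (Nat.eq_of_mul_eq_mul_right (Nat.zero_lt_of_lt j.2) (Nat.add_right_cancel h1)).symm

end SimpleGraph

/-! ### The asymptotic bounds -/

theorem prod_range_sub_div (r : ℕ) (hr : 1 ≤ r) :
    ∏ i ∈ Finset.range r, (((r : ℝ) - i) / (r * (i + 1))) = 1 / (r : ℝ) ^ r := by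
  have hr0 : (r : ℝ) ≠ 0 := by positivity
  have h1 : ∏ i ∈ Finset.range r, ((r : ℝ) - i) = ∏ i ∈ Finset.range r, ((i : ℝ) + 1) := by
    rw [← Finset.prod_range_reflect fun i : ℕ => (i : ℝ) + 1]
    refine Finset.prod_congr rfl fun i hi => ?_
    have := Finset.mem_range.1 hi
    rw [show r - 1 - i = r - (i + 1) by omega, Nat.cast_sub (by omega)]
    push_cast
    ring
  have h2 : ∏ i ∈ Finset.range r, ((i : ℝ) + 1) ≠ 0 :=
    Finset.prod_ne_zero_iff.2 fun i _ => by positivity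
  rw [Finset.prod_div_distrib, Finset.prod_mul_distrib, h1, Finset.prod_const, Finset.card_range]
  field_simp

open scoped Classical in
theorem SimpleGraph.Colorable.eventually_exClique_le {W : Type*} [Finite W] {H : SimpleGraph W}
    {r : ℕ} (hr : 1 ≤ r) (hH : H.Colorable (r + 1)) {δ : ℝ} (hδ : 0 < δ) :
    ∀ᶠ n : ℕ in atTop, (exClique r n H : ℝ) ≤ (1 / (r : ℝ) ^ r + δ) * (n : ℝ) ^ r := by
  have hr0 : (0 : ℝ) < r := by exact_mod_cast hr
  have hcont : ContinuousAt
      (fun η : ℝ => ∏ i ∈ Finset.range r, (((r : ℝ) - i) / (r * (i + 1)) + η)) 0 := by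
    fun_prop
  have hlt : ∏ i ∈ Finset.range r, (((r : ℝ) - i) / (r * (i + 1)) + 0) <
      1 / (r : ℝ) ^ r + δ := by
    simpa only [add_zero, prod_range_sub_div r hr] using lt_add_of_pos_right _ hδ
  have hev := hcont.eventually (gt_mem_nhds hlt)
  obtain ⟨η, hη, hη0⟩ := ((hev.filter_mono nhdsWithin_le_nhds).and
    (self_mem_nhdsWithin (s := Set.Ioi (0 : ℝ)))).exists
  filter_upwards [hH.eventually_card_cliqueFinset_le (c := η / (r : ℝ) ^ r) (by positivity)]
    with n hn
  have key : ∀ G : SimpleGraph (Fin n), H.Free G →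
      ((G.cliqueFinset r).card : ℝ) ≤ (1 / (r : ℝ) ^ r + δ) * (n : ℝ) ^ r := by
    intro G hG
    -- In the nontrivial case, the lower bound on `r`-cliques turns the absolute bound with `c = η /
    -- r ^ r` into the ratio bound that Moon–Moser needs.
    by_cases hsmall : ((G.cliqueFinset r).card : ℝ) ≤ 1 / (r : ℝ) ^ r * (n : ℝ) ^ r
    · refine hsmall.trans ?_
      gcongr
      linarith
    · push Not at hsmall
      have := G.card_cliqueFinset_le_prod hr hη0.le (by
        rw [Fintype.card_fin]
        calc ((G.cliqueFinset (r + 1)).card : ℝ) ≤ η / (r : ℝ) ^ r * (n : ℝ) ^ (r + 1) := hn G hG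
          _ = η * n * (1 / (r : ℝ) ^ r * (n : ℝ) ^ r) := by ring
          _ ≤ _ := by gcongr) le_rfl
      rw [Fintype.card_fin] at this
      refine this.trans ?_
      gcongr
  rw [exClique]
  refine (Nat.le_floor_iff (by positivity)).1 (Finset.sup_le fun G hG => Nat.le_floor ?_)
  exact key G (Finset.mem_filter.1 hG).2

theorem div_pow_le_exClique {W : Type*} {H : SimpleGraph W} {r : ℕ} (hr : 1 ≤ r)
    (hH : ¬ H.Colorable r) (n : ℕ) : (n / r) ^ r ≤ exClique r n H := by
  classical
  have hfree : H.Free (SimpleGraph.turanGraph n r) := by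
    rintro ⟨f⟩
    -- A copy of `H` would inherit the coloring by residues.
    refine hH ⟨SimpleGraph.Coloring.mk (fun v => ⟨(f v : Fin n) % r, Nat.mod_lt _ hr⟩) ?_⟩
    intro a b hab h
    exact SimpleGraph.turanGraph_adj.1 (f.toHom.map_adj hab) (congrArg Fin.val h)
  refine SimpleGraph.div_pow_le_card_cliqueFinset_turanGraph.trans ?_
  rw [exClique]
  convert Finset.le_sup (f := fun G : SimpleGraph (Fin n) => (G.cliqueFinset r).card)
      (Finset.mem_filter.2 ⟨Finset.mem_univ _, hfree⟩)

theorem theorem4 {W : Type*} [Finite W] (H : SimpleGraph W) (r : ℕ) (hr : 1 ≤ r)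
    (hH : H.chromaticNumber = ((r + 1 : ℕ) : ℕ∞)) :
    ∃ ε : ℕ → ℝ, Tendsto ε atTop (𝓝 0) ∧
      ∀ n : ℕ, (exClique r n H : ℝ) = (1 / (r : ℝ) ^ r + ε n) * (n : ℝ) ^ r := by
  have hr0 : (0 : ℝ) < r := by exact_mod_cast hr
  have hcol : H.Colorable (r + 1) := SimpleGraph.chromaticNumber_le_iff_colorable.1 hH.le
  have hncol : ¬ H.Colorable r := fun h => by
    have := h.chromaticNumber_le
    rw [hH, Nat.cast_le] at this
    omega
  refine ⟨fun n => (exClique r n H : ℝ) / (n : ℝ) ^ r - 1 / (r : ℝ) ^ r, ?_, ?_⟩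
  · have hlow : Tendsto (fun n : ℕ => ((n / r : ℕ) / (n : ℝ)) ^ r) atTop
        (𝓝 (1 / (r : ℝ) ^ r)) := by
      have h := ((tendsto_nat_floor_mul_div_atTop (R := ℝ) (a := (r : ℝ)⁻¹) (by positivity)).comp
        tendsto_natCast_atTop_atTop).pow r
      rw [one_div, ← inv_pow]
      refine h.congr fun n => ?_
      simp only [Function.comp_apply]
      rw [inv_mul_eq_div, Nat.floor_div_natCast, Nat.floor_natCast]
    rw [tendsto_order]
    constructor
    · intro a ha
      filter_upwards [hlow.eventually (lt_mem_nhds (show 1 / (r : ℝ) ^ r + a < _ by linarith))]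
        with n hn
      have h1 : ((n / r : ℕ) / (n : ℝ)) ^ r ≤ (exClique r n H : ℝ) / (n : ℝ) ^ r := by
        rw [div_pow]
        gcongr
        exact_mod_cast div_pow_le_exClique hr hncol n
      linarith
    · intro a ha
      filter_upwards [hcol.eventually_exClique_le hr (half_pos ha), eventually_ge_atTop 1]
        with n hn hn1
      have hn0 : (0 : ℝ) < n := by exact_mod_cast hn1
      have := (div_le_iff₀ (by positivity)).2 hn
      linarith
  · intro n
    -- At `n = 0` division by `n ^ r` is void, but both sides vanish because `r ≥ 1`.
    rcases Nat.eq_zero_or_pos n with rfl | hn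
    · classical
      have h0 : exClique r 0 H = 0 := by
        refine (Finset.sup_eq_bot_iff _ _).2 fun G _ => ?_
        change _ = 0
        rw [Finset.card_eq_zero, Finset.eq_empty_iff_forall_notMem]
        intro T hT
        have h := (SimpleGraph.mem_cliqueFinset_iff.1 hT).card_eq
        rw [Finset.eq_empty_of_isEmpty T, Finset.card_empty] at h
        omega
      rw [h0]
      simp [show r ≠ 0 by omega]
    · have hn0 : (0 : ℝ) < n := by exact_mod_cast hn
      rw [add_sub_cancel, div_mul_cancel₀ _ (by positivity)]
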